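/- **Setting.** A compatibility scenario $\Upsilon=(\mathcal M,\mathcal C,(\mathcal O^x)_{x\in\mathcal M})$ consists of a finite set $\mathcal M$ of measurements, a family $\mathcal C$ of subsets of $\mathcal M$ (the maximal contexts), none of which contains another, and finite non-empty outcome sets $\mathcal O^x$. A behavior $B=(p_\gamma)_{\gamma\in\mathcal C}$ gives a probability distribution $p_\gamma$ on $\mathcal O^\gamma=\prod_{x\in\gamma}\mathcal O^x$ for each context. It is non-disturbing ($B\in\mathrm{ND}(\Upsilon)$) if the marginals of $p_\gamma,p_{\gamma'}$ on $\gamma\cap\gamma'$ agree for all $\gamma,\gamma'$, and noncontextual ($B\in\mathrm{NC}(\Upsilon)$) if all $p_\gamma$ are marginals of one probability distribution on $\prod_{x\in\mathcal M}\mathcal O^x$. The objects are all non-disturbing behaviors in all scenarios. **Noncontextual wirings (NCW).** A wiring from $\Upsilon$ to $\Upsilon'=(\mathcal M',\mathcal C',\mathcal O')$ uses a noncontextual pre-processing box $p_\beta(\mathbf r)$ with the measurements and contexts of $\Upsilon'$ (and arbitrary finite outcome sets) and a noncontextual post-processing box $p_\delta(\mathbf t)$ in an arbitrary scenario. On input $\beta\in\mathcal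 C'$ it draws $\mathbf r$, measures the context $\gamma=f(\mathbf r,\beta)$ of $\Upsilon$ with outcome $\mathbf s$, each $x\in\beta$ being assigned a measurement $\gamma_x\in\gamma$; then the post-processing context $\delta=\{g_x(s_{\gamma_x}\mid \mathbf r,\beta):x\in\beta\}$ is measured, and the outcome of $x$ is a relabelling of the outcome of $g_x(s_{\gamma_x}\mid\mathbf r,\beta)$. Up to this relabelling, $$p_\beta(\mathbf t)=\sum_{\mathbf r,\mathbf s}p_\beta(\mathbf r)\,p_{\gamma=f(\mathbf r,\beta)}(\mathbf s)\,p_{\delta=g(\mathbf s\mid\mathbf r,\beta)}(\mathbf t).$$ The feed-forward of $\mathbf r,\beta$ must not create contextuality. This is required in either of two ways, and the theorem holds for each of them: (a) per wire: $\gamma_x$ and $g_x(\cdot\mid\mathbf r,\beta)$ depend on $x$ and $r_x$ only; (b) full: they may depend on all of $\mathbf r$ and $\beta$, and the wiring has to map $\mathrm{ND}(\Upsilon)$ into $\mathrm{ND}(\Upsilon')$ and $\mathrm{NC}(\Upsilon)$ into $\mathrm{NC}(\Upsilon')$. Write $B\to B'$ if some NCW takes $B$ to $B'$. The objects $B,B'$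 are equivalent if $B\to B'$ and $B'\to B$, and $[B]$ is the set of all objects equivalent to $B$. The pre-order is locally finite if for every inequivalent pair $(B_1,B_2)$ there are only finitely many classes $[B]$ with $B_1\to B\to B_2$; otherwise it is locally infinite. **The $n$-cycle.** For $n\ge 3$ the scenario $\Upsilon_n$ has measurements $x_i$, $i\in\mathbb Z/n$, with outcomes $0,1$, and contexts $\{x_i,x_{i+1}\}$. Let $k$ be a choice of signs $a_i\in\{1,-1\}$, an odd number of which are $-1$, and put $I_k(B)=\sum_i a_i\langle x_ix_{i+1}\rangle$ with $\langle x_ix_{i+1}\rangle=p(00)+p(11)-p(10)-p(01)$. Let $B_k$ be the behavior in which, in each context $\{x_i,x_{i+1}\}$, the two joint outcomes that are equal (if $a_i=1$) or different (if $a_i=-1$) have probability $\tfrac12$ each; then $I_k(B_k)=n$. Let $B_\varnothing$ be the behavior with all joint outcomes of probability $\tfrac14$, let $B_k'=\frac{n-2}{n}B_k+\frac2nB_\varnothing$, and $B_\varepsilon=\varepsilon B_k+(1-\varepsilon)B_k'$ for $\varepsilon\in[0,1]$; these form the segment $\mathrm P_k^{(n)}$. The cost of $B\in\mathrm{ND}(\Upsilon_n)$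 is $\mathsf c_k(B)=\inf\{I_k(B'):B'\in\mathrm P_k^{(n)},\ B'\to B\}\in\mathbb R\cup\{\pm\infty\}$, with $\inf\varnothing=+\infty$. **Theorem.** The pre-order of NCW is locally infinite. More precisely, there are objects $B_1\to B_2$, not equivalent, such that the set of equivalence classes $\{[B]:B_1\to B\to B_2\}$ is uncountable. In detail, for every $n\ge3$, every $k$ and all $0\le\varepsilon_1<\varepsilon_2\le1$: for each $\varepsilon\in[\varepsilon_1,\varepsilon_2]$ one has $B_{\varepsilon_2}\to B_\varepsilon\to B_{\varepsilon_1}$ and $\mathsf c_k(B_\varepsilon)=n+2(\varepsilon-1)$; the behaviors $B_\varepsilon$, $\varepsilon\in[\varepsilon_1,\varepsilon_2]$, are pairwise inequivalent; hence the set $\{[B_\varepsilon]:\varepsilon\in[\varepsilon_1,\varepsilon_2]\}$ and the set of all classes $[B]$ with $B_{\varepsilon_2}\to B\to B_{\varepsilon_1}$ are uncountable. -/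

import Mathlib

/-- A compatibility scenario: a finite set `M` of measurements, a finite family of maximal contexts
(indexed by `Ctx`, the context with index `γ` being the set `supp γ`; the antichain condition makes
`supp` injective, so this is a family of subsets), and a finite outcome set for each measurement. -/
structure Scenario where
  M : Type
  Ctx : Type
  supp : Ctx → Finset M
  O : M → Type
  [finM : Fintype M]
  [decM : DecidableEq M]
  [finCtx : Fintype Ctx]
  [finO : ∀ x, Fintype (O x)]
  [decO : ∀ x, DecidableEq (O x)]
  [neO : ∀ x, Nonempty (O x)]
  antichain : ∀ γ γ', supp γ ⊆ supp γ' → γ = γ'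

namespace Scenario

attribute [instance] finM decM finCtx finO decO neO

/-- Joint outcomes of a set of measurements. -/
abbrev Out (Υ : Scenario) (η : Finset Υ.M) : Type := ∀ x : η, Υ.O x

/-- Families of real functions on the joint outcomes, one for each maximal context. -/
abbrev Table (Υ : Scenario) : Type := ∀ γ : Υ.Ctx, Υ.Out (Υ.supp γ) → ℝ

variable {Υ : Scenario}

/-- Restriction of a joint outcome to a smaller set of measurements. -/
def restrict {η θ : Finset Υ.M} (h : η ⊆ θ) (s : Υ.Out θ) : Υ.Out η :=
  fun x => s ⟨x, h x.2⟩

/-- The marginal, on a subset `η` of the set `θ`, of a function on joint outcomes. -/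
def marginal {η θ : Finset Υ.M} (h : η ⊆ θ) (p : Υ.Out θ → ℝ) (u : Υ.Out η) : ℝ :=
  ∑ s : Υ.Out θ, if restrict h s = u then p s else 0

/-- A behavior (box): a probability distribution on joint outcomes for each maximal context. -/
def IsBehavior (B : Υ.Table) : Prop :=
  ∀ γ, (∀ s, 0 ≤ B γ s) ∧ ∑ s, B γ s = 1

variable (Υ)

/-- The non-disturbing behaviors: marginals agree on intersections of contexts. -/
def ND : Set Υ.Table :=
  {B | IsBehavior B ∧ ∀ γ γ' : Υ.Ctx, ∀ u : Υ.Out (Υ.supp γ ∩ Υ.supp γ'),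
    marginal Finset.inter_subset_left (B γ) u = marginal Finset.inter_subset_right (B γ') u}

/-- The noncontextual behaviors: those with a global section, that is a probability distribution
on joint outcomes of all measurements whose marginals on the contexts are the given ones. -/
def NC : Set Υ.Table :=
  {B | IsBehavior B ∧ ∃ P : (∀ x, Υ.O x) → ℝ, (∀ t, 0 ≤ P t) ∧ ∑ t, P t = 1 ∧
    ∀ γ, ∀ s : Υ.Out (Υ.supp γ), (∑ t, if (fun x : Υ.supp γ => t x) = s then P t else 0) = B γ s}

/-- The scenario with the same measurements and contexts, and other outcome sets. -/
abbrev withOutcomes (O' : Υ.M → Type) [∀ x, Fintype (O' x)] [∀ x, DecidableEq (O' x)]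
    [∀ x, Nonempty (O' x)] : Scenario where
  M := Υ.M
  Ctx := Υ.Ctx
  supp := Υ.supp
  O := O'
  antichain := Υ.antichain

end Scenario

open Scenario

/-- The data of a noncontextual wiring from `Υ` to `Υ'`.

On input `β`, a context of `Υ'`, the noncontextual pre-processing box (whose measurements and
contexts are those of `Υ'`) yields `r`, and the context `f β r` of `Υ` is measured, with outcome
`s`. The wire that belongs to `x ∈ β` carries the measurement `src β r x` of that context. Its
outcome `o` alone selects, given `r` and `β`, the post-processing measurement `g β r x _ o`. The
measurements selected by the wires make up a context `δ β r s` of the post-processing scenario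
`pos`, which carries a noncontextual box. (`pos` is the scenario obtained by joining the scenarios
available for the various pairs `(r, β)`.) The outcome of the measurement selected by the wire `x`,
relabelled by `dec`, is the outcome of `x`. -/
structure Wiring (Υ Υ' : Scenario) where
  preO : Υ'.M → Type
  [finPre : ∀ x, Fintype (preO x)]
  [decPre : ∀ x, DecidableEq (preO x)]
  [nePre : ∀ x, Nonempty (preO x)]
  pre : (Υ'.withOutcomes preO).Table
  pre_nc : pre ∈ (Υ'.withOutcomes preO).NC
  f : ∀ β : Υ'.Ctx, (∀ x : Υ'.supp β, preO x) → Υ.Ctx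
  src : ∀ (β : Υ'.Ctx) (r : ∀ x : Υ'.supp β, preO x), Υ'.supp β → Υ.supp (f β r)
  pos : Scenario
  posBox : pos.Table
  pos_nc : posBox ∈ pos.NC
  g : ∀ β : Υ'.Ctx, (∀ x : Υ'.supp β, preO x) → Υ'.supp β → ∀ m : Υ.M, Υ.O m → pos.M
  δ : ∀ (β : Υ'.Ctx) (r : ∀ x : Υ'.supp β, preO x), Υ.Out (Υ.supp (f β r)) → pos.Ctx
  supp_δ : ∀ β r s, pos.supp (δ β r s) =
    Finset.univ.image fun x : Υ'.supp β => g β r x (src β r x) (s (src β r x))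
  dec : ∀ (x : Υ'.M) (d : pos.M), pos.O d → Υ'.O x

namespace Wiring

attribute [instance] finPre decPre nePre

variable {Υ Υ' : Scenario} (W : Wiring Υ Υ')

theorem g_mem (β : Υ'.Ctx) (r : ∀ x : Υ'.supp β, W.preO x) (s : Υ.Out (Υ.supp (W.f β r)))
    (x : Υ'.supp β) :
    W.g β r x (W.src β r x) (s (W.src β r x)) ∈ W.pos.supp (W.δ β r s) := by
  rw [W.supp_δ]
  exact Finset.mem_image_of_mem _ (Finset.mem_univ x)

/-- The joint outcome of the context `β` that the final outcome `t` stands for. -/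
def output (β : Υ'.Ctx) (r : ∀ x : Υ'.supp β, W.preO x) (s : Υ.Out (Υ.supp (W.f β r)))
    (t : W.pos.Out (W.pos.supp (W.δ β r s))) : Υ'.Out (Υ'.supp β) :=
  fun x => W.dec x _ (t ⟨_, W.g_mem β r s x⟩)

/-- The action of a wiring:
`p_β(t) = ∑_{r, s} p_β(r) p_{γ = f(r)}(s) p_{δ = g(s | r, β)}(t)`. -/
noncomputable def apply (B : Υ.Table) : Υ'.Table := fun β t' =>
  ∑ r : (∀ x : Υ'.supp β, W.preO x), ∑ s : Υ.Out (Υ.supp (W.f β r)),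
    ∑ t : W.pos.Out (W.pos.supp (W.δ β r s)),
      if W.output β r s t = t' then W.pre β r * B (W.f β r) s * W.posBox (W.δ β r s) t else 0

/-- The wire that belongs to `x` acts on the information of `x` and of its own pre-processing
outcome only. -/
def IsLocal : Prop :=
  ∀ (β β' : Υ'.Ctx) (r : ∀ x : Υ'.supp β, W.preO x) (r' : ∀ x : Υ'.supp β', W.preO x)
    (x : Υ'.M) (h : x ∈ Υ'.supp β) (h' : x ∈ Υ'.supp β'), r ⟨x, h⟩ = r' ⟨x, h'⟩ →
      (W.src β r ⟨x, h⟩ : Υ.M) = W.src β' r' ⟨x, h'⟩ ∧ W.g β r ⟨x, h⟩ = W.g β' r' ⟨x, h'⟩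

/-- The wiring creates neither disturbance nor contextuality. -/
def IsFree : Prop :=
  (∀ B ∈ Υ.ND, W.apply B ∈ Υ'.ND) ∧ ∀ B ∈ Υ.NC, W.apply B ∈ Υ'.NC

end Wiring

/-- Two ways to confine the classical feed-forward of `r` and `β` so that it cannot be used to
create contextuality. -/
inductive FeedForward
  /-- Each wire knows its own part of `r` and `β` only. -/
  | perWire
  /-- Every wire knows all of `r` and `β`, and the operation has to be a free one. -/
  | full

/-- The noncontextual wirings among the wirings, for the given kind of feed-forward. -/
def IsNCW (m : FeedForward) {Υ Υ' : Scenario} (W : Wiring Υ Υ') : Prop :=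
  match m with
  | .perWire => W.IsLocal
  | .full => W.IsFree

/-- The objects of the resource theory: non-disturbing behaviors in arbitrary scenarios. -/
abbrev Resource : Type 1 := Σ Υ : Scenario, Υ.ND

/-- The pre-order `B → B'`: some noncontextual wiring takes `B` to `B'`. -/
def Converts (m : FeedForward) (B B' : Resource) : Prop :=
  ∃ W : Wiring B.1 B'.1, IsNCW m W ∧ W.apply B.2 = B'.2

def Equivalent (m : FeedForward) (B B' : Resource) : Prop :=
  Converts m B B' ∧ Converts m B' B

/-- The equivalence class `[B]`. -/
def equivClass (m : FeedForward) (B : Resource) : Set Resource :=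
  {B' | Equivalent m B B'}

/-- The set of the equivalence classes `[B]` with `B₁ → B → B₂`. -/
def classesBetween (m : FeedForward) (B₁ B₂ : Resource) : Set (Set Resource) :=
  equivClass m '' {B | Converts m B₁ B ∧ Converts m B B₂}

/-- The pre-order is locally finite: only finitely many equivalence classes lie in the interval of
any two inequivalent objects. -/
def IntervalsFinite (m : FeedForward) : Prop :=
  ∀ B₁ B₂ : Resource, ¬ Equivalent m B₁ B₂ → (classesBetween m B₁ B₂).Finite

section Cycle

variable (n : ℕ) [Fact (3 ≤ n)]

instance cycleNeZero : NeZero n := ⟨by have := Fact.out (p := 3 ≤ n); omega⟩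

theorem cycle_succ_ne (i : Fin n) : i + 1 ≠ i := by
  have h3 := Fact.out (p := 3 ≤ n)
  intro h
  have h1 : (1 : Fin n) = 0 := by simpa using h
  have := congrArg Fin.val h1
  rw [Fin.val_one', Fin.val_zero, Nat.mod_eq_of_lt (by omega)] at this
  omega

theorem cycle_succ_succ_ne (i : Fin n) : i + 1 + 1 ≠ i := by
  have h3 := Fact.out (p := 3 ≤ n)
  intro h
  have h1 : (1 + 1 : Fin n) = 0 := by simpa [add_assoc] using h
  have := congrArg Fin.val h1
  rw [Fin.val_add, Fin.val_one', Fin.val_zero, Nat.mod_eq_of_lt (by omega : 1 < n),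
    Nat.mod_eq_of_lt (by omega)] at this
  omega

/-- The `n`-cycle scenario, `n ≥ 3`: measurements `x_i`, `i ∈ ℤ/n`, with outcomes `0` and `1`
(`false` and `true`), and the maximal contexts `{x_i, x_{i+1}}`. -/
abbrev nCycle : Scenario where
  M := Fin n
  Ctx := Fin n
  supp i := {i, i + 1}
  O _ := Bool
  antichain i j h := by
    have h1 : i ∈ ({j, j + 1} : Finset (Fin n)) := h (by simp)
    have h2 : i + 1 ∈ ({j, j + 1} : Finset (Fin n)) := h (by simp)
    simp only [Finset.mem_insert, Finset.mem_singleton] at h1 h2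
    rcases h1 with h1 | h1
    · exact h1
    · subst h1
      rcases h2 with h2 | h2
      · exact absurd h2 (cycle_succ_succ_ne n j)
      · exact absurd h2 (cycle_succ_ne n _)

/-- The label `k` of a facet inequality of the noncontextual polytope of the `n`-cycle: signs
`a_i = ±1`, an odd number of which are `-1`. -/
structure CycleFacet (n : ℕ) where
  a : Fin n → ℤˣ
  odd : Odd (Finset.univ.filter fun i => a i = -1).card

variable {n}

/-- The outcome of `x_i` in a joint outcome of the `i`-th context `{x_i, x_{i+1}}`. -/
def fstOut {i : Fin n} (s : (nCycle n).Out ((nCycle n).supp i)) : Bool := s ⟨i, by simp⟩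

/-- The outcome of `x_{i+1}` in a joint outcome of the `i`-th context `{x_i, x_{i+1}}`. -/
def sndOut {i : Fin n} (s : (nCycle n).Out ((nCycle n).supp i)) : Bool := s ⟨i + 1, by simp⟩

/-- The two-point correlation `⟨x_i x_{i+1}⟩ = p(00) + p(11) - p(10) - p(01)`. -/
noncomputable def corr (B : (nCycle n).Table) (i : Fin n) : ℝ :=
  ∑ s, (if fstOut s = sndOut s then 1 else -1) * B i s

/-- The functional `I_k(B) = ∑ a_i ⟨x_i x_{i+1}⟩`. -/
noncomputable def CycleFacet.I (k : CycleFacet n) (B : (nCycle n).Table) : ℝ :=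
  ∑ i, ((k.a i : ℤ) : ℝ) * corr B i

/-- The contextual vertex `B_k` that reaches the algebraic maximum `n` of `I_k`: all single outcomes
are uniform, and those of `x_i`, `x_{i+1}` are equal if `a_i = 1` and different if `a_i = -1`. -/
noncomputable def CycleFacet.vertex (k : CycleFacet n) : (nCycle n).Table :=
  fun i s => if (fstOut s = sndOut s ↔ k.a i = 1) then 1 / 2 else 0

/-- The behavior with all joint outcomes equally likely. -/
noncomputable def uniformTable : (nCycle n).Table := fun _ _ => 1 / 4

/-- `B_k' = ((n-2)/n) B_k + (2/n) B_∅`. -/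
noncomputable def CycleFacet.facetPoint (k : CycleFacet n) : (nCycle n).Table :=
  (((n : ℝ) - 2) / n) • k.vertex + (2 / (n : ℝ)) • uniformTable

/-- The point `ε B_k + (1 - ε) B_k'` of the segment between `B_k'` and `B_k`. -/
noncomputable def CycleFacet.segmentTable (k : CycleFacet n) (ε : ℝ) : (nCycle n).Table :=
  ε • k.vertex + (1 - ε) • k.facetPoint

/-- Joint outcomes of the `i`-th context are pairs of outcomes. -/
def outEquiv (i : Fin n) : (nCycle n).Out ((nCycle n).supp i) ≃ Bool × Bool where
  toFun s := (fstOut s, sndOut s)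
  invFun p x := if (x : Fin n) = i then p.1 else p.2
  left_inv s := by
    funext ⟨x, hx⟩
    simp only [Finset.mem_insert, Finset.mem_singleton] at hx
    rcases hx with rfl | rfl
    · simp [fstOut]
    · exact if_neg (cycle_succ_ne n i)
  right_inv p := Prod.ext (if_pos rfl) (if_neg (cycle_succ_ne n i))

theorem segmentTable_eq (k : CycleFacet n) (ε : ℝ) :
    k.segmentTable ε = fun i s =>
      if (fstOut s = sndOut s ↔ k.a i = 1) then 1 / 2 - (1 - ε) / (2 * n)
      else (1 - ε) / (2 * n) := by
  have h3 := Fact.out (p := 3 ≤ n)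
  have hn : (n : ℝ) ≠ 0 := by positivity
  funext i s
  simp only [CycleFacet.segmentTable, CycleFacet.facetPoint, CycleFacet.vertex, uniformTable,
    Pi.add_apply, Pi.smul_apply, smul_eq_mul]
  split_ifs
  · field_simp
    ring
  · field_simp
    ring

theorem segmentTable_isBehavior (k : CycleFacet n) (ε : unitInterval) :
    IsBehavior (k.segmentTable ε) := by
  have h3 := Fact.out (p := 3 ≤ n)
  have hn : (3 : ℝ) ≤ n := by exact_mod_cast h3
  obtain ⟨ε, h0, h1⟩ := ε
  have hd : 0 ≤ (1 - ε) / (2 * n) := div_nonneg (by linarith) (by linarith)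
  have hd' : (1 - ε) / (2 * n) ≤ 1 / 2 := by
    rw [div_le_div_iff₀ (by linarith) (by norm_num)]
    nlinarith
  rw [segmentTable_eq]
  refine fun i => ⟨fun s => ?_, ?_⟩
  · dsimp only
    split_ifs
    · linarith
    · exact hd
  · rw [← (outEquiv i).symm.sum_comp]
    have hf : ∀ p, fstOut ((outEquiv i).symm p) = p.1 := fun p =>
      congrArg Prod.fst ((outEquiv i).apply_symm_apply p)
    have hs : ∀ p, sndOut ((outEquiv i).symm p) = p.2 := fun p =>
      congrArg Prod.snd ((outEquiv i).apply_symm_apply p)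
    simp only [hf, hs, Fintype.sum_prod_type, Fintype.sum_bool]
    by_cases ha : k.a i = 1
    · simp only [ha]
      norm_num
    · simp only [ha]
      norm_num

/-- Exchange of the outcomes `0` and `1` of all measurements. -/
def flipOut (η : Finset (Fin n)) : (nCycle n).Out η ≃ (nCycle n).Out η :=
  Equiv.piCongrRight fun _ => Equiv.boolNot

/-- A behavior of the cycle that is invariant under the exchange of `0` and `1` has uniform
marginals on single measurements, hence is non-disturbing. -/
theorem nonDisturbing_of_flip (B : (nCycle n).Table) (hB : IsBehavior B)
    (hflip : ∀ i s, B i (flipOut _ s) = B i s) : B ∈ (nCycle n).ND := by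
  have key : ∀ (i : Fin n) (η : Finset (Fin n)) (h : η ⊆ (nCycle n).supp i)
      (u : (nCycle n).Out η), η.card ≤ 1 →
      marginal h (B i) u = if η = ∅ then 1 else 1 / 2 := by
    intro i η h u hη
    split_ifs with he
    · subst he
      rw [← (hB i).2]
      refine Finset.sum_congr rfl fun s _ => if_pos ?_
      funext x
      exact absurd x.2 (Finset.notMem_empty _)
    · obtain ⟨x, rfl⟩ : ∃ x, η = {x} := Finset.card_eq_one.1
        (le_antisymm hη (Finset.card_pos.2 (Finset.nonempty_iff_ne_empty.2 he)))
      have h1 : marginal h (B i) (flipOut _ u) = marginal h (B i) u := by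
        unfold marginal
        rw [← (flipOut _).sum_comp]
        refine Finset.sum_congr rfl fun s _ => ?_
        have : restrict h (flipOut _ s) = flipOut _ (restrict h s) := rfl
        simp only [this, hflip, (flipOut _).apply_eq_iff_eq]
      have h2 : marginal h (B i) u + marginal h (B i) (flipOut _ u) = 1 := by
        rw [← (hB i).2]
        unfold marginal
        rw [← Finset.sum_add_distrib]
        refine Finset.sum_congr rfl fun s _ => ?_
        have e : ∀ v w : (nCycle n).Out {x},
            v = w ↔ v ⟨x, by simp⟩ = w ⟨x, by simp⟩ := fun v w =>
          ⟨fun h => h ▸ rfl, fun h => funext fun ⟨y, hy⟩ => by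
            obtain rfl := Finset.mem_singleton.1 hy
            exact h⟩
        have e' : flipOut _ u ⟨x, by simp⟩ = ! u ⟨x, by simp⟩ := rfl
        simp only [e, e']
        cases restrict h s ⟨x, by simp⟩ <;> cases u ⟨x, by simp⟩ <;> simp
      linarith
  refine ⟨hB, fun i j u => ?_⟩
  by_cases hij : i = j
  · subst hij
    rfl
  · have hc : ((nCycle n).supp i ∩ (nCycle n).supp j).card ≤ 1 := by
      by_contra hc
      have h2 : ((nCycle n).supp i).card ≤ 2 := Finset.card_le_two
      have := Finset.eq_of_subset_of_card_le
        (Finset.inter_subset_left (s₁ := (nCycle n).supp i) (s₂ := (nCycle n).supp j)) (by omega)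
      exact hij ((nCycle n).antichain i j (Finset.inter_eq_left.1 this))
    rw [key i _ _ u hc, key j _ _ u hc]

theorem segmentTable_mem_ND (k : CycleFacet n) (ε : unitInterval) :
    k.segmentTable ε ∈ (nCycle n).ND := by
  refine nonDisturbing_of_flip _ (segmentTable_isBehavior k ε) fun i s => ?_
  have h1 : fstOut (flipOut _ s) = ! fstOut s := rfl
  have h2 : sndOut (flipOut _ s) = ! sndOut s := rfl
  rw [segmentTable_eq]
  simp only [h1, h2, Bool.not_inj_iff]

/-- The points of the segment `P_k`, as objects of the resource theory. -/
noncomputable def CycleFacet.segment (k : CycleFacet n) (ε : unitInterval) : Resource :=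
  ⟨nCycle n, k.segmentTable ε, segmentTable_mem_ND k ε⟩

/-- The cost monotone `c_k(B) = min {I_k(B') | B' ∈ P_k, B' → B}`, which is `+∞` if there is no such
`B'`. -/
noncomputable def CycleFacet.cost (m : FeedForward) (k : CycleFacet n)
    (B : (nCycle n).ND) : EReal :=
  sInf {v | ∃ ε : unitInterval, Converts m (k.segment ε) ⟨nCycle n, B⟩ ∧
    v = ((k.I (k.segmentTable ε) : ℝ) : EReal)}

end Cycle

/-! A wiring acts linearly on the table it is fed, sends behaviors to behaviors, and sends
noncontextual behaviors to noncontextual ones. On the cycle, `I` is linear, at most `n` on behaviors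
and at most `n - 2` on noncontextual ones. The segment joins the noncontextual point `B_0` to the
vertex `B_1`, and `I` equals `n - 2 + 2ε` at `B_ε`. If a wiring takes `B_ε'` to `B_ε`, splitting
`B_ε' = ε' B_1 + (1 - ε') B_0` bounds `I` of the image by `ε' n + (1 - ε')(n - 2) = n - 2 + 2ε'`, so
`ε ≤ ε'`.

Conversely, if `ε ≤ ε'`, shared randomness mixes `B_ε'` with `B_0` to give `B_ε`. The segment is
therefore ordered exactly like the unit interval, distinct points are inequivalent, and every
nondegenerate subinterval yields uncountably many classes. The carrying lemmas are
`IsLocal.apply_mem_NC`, `converts_mix`, `I_le_of_mem_NC`, `segmentTable_zero_mem_NC` and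
`le_of_converts_segment`. -/

/-! ### Hidden-variable mixtures and convexity of ND and NC -/

namespace Scenario

variable {Υ : Scenario}

/-- Change of variables for a push-forward: averages over the outcomes of one context become
averages over a hidden variable that serves all contexts. -/
theorem sum_mul_mixture {ι : Type} [Fintype ι] (w : ι → ℝ) (y : ι → ∀ x, Υ.O x)
    {γ : Υ.Ctx} {p : Υ.Out (Υ.supp γ) → ℝ}
    (hp : ∀ s, p s = ∑ i, if (fun x : Υ.supp γ => y i x) = s then w i else 0)
    (φ : Υ.Out (Υ.supp γ) → ℝ) :
    ∑ s, φ s * p s = ∑ i, φ (fun x => y i x) * w i := by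
  simp only [hp, Finset.mul_sum]
  rw [Finset.sum_comm]
  simp only [mul_ite, mul_zero, Finset.sum_ite_eq, Finset.mem_univ, if_true]

/-- A mixture of deterministic global assignments is noncontextual. -/
theorem mem_NC_of_mixture {ι : Type} [Fintype ι] (w : ι → ℝ) (y : ι → ∀ x, Υ.O x)
    (hw : ∀ i, 0 ≤ w i) (h1 : ∑ i, w i = 1) {B : Υ.Table}
    (hB : ∀ γ s, B γ s = ∑ i, if (fun x : Υ.supp γ => y i x) = s then w i else 0) :
    B ∈ Υ.NC := by
  -- The global section is the push-forward of `w` along `y`.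
  refine ⟨fun γ => ⟨fun s => ?_, ?_⟩, fun t => ∑ i, if y i = t then w i else 0,
    fun t => ?_, ?_, fun γ s => ?_⟩
  · rw [hB]
    exact Finset.sum_nonneg fun i _ => by split_ifs <;> simp [hw]
  · have := sum_mul_mixture w y (hB γ) fun _ => 1
    simpa [h1] using this
  · exact Finset.sum_nonneg fun i _ => by split_ifs <;> simp [hw]
  · rw [Finset.sum_comm]
    simpa using h1
  · rw [hB]
    have e : ∀ t : (∀ x, Υ.O x), (if (fun x : Υ.supp γ => t x) = s then
        ∑ i, (if y i = t then w i else 0) else 0) =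
        ∑ i, if y i = t then (if (fun x : Υ.supp γ => t x) = s then w i else 0) else 0 := by
      intro t
      split_ifs <;> simp
    simp only [e]
    rw [Finset.sum_comm]
    refine Finset.sum_congr rfl fun i _ => ?_
    rw [Finset.sum_ite_eq]
    simp

/-- The mixture with weights `w` of the deterministic global assignments `y`. -/
def mixture {ι : Type} [Fintype ι] (w : ι → ℝ) (y : ι → ∀ x, Υ.O x) : Υ.Table :=
  fun γ s => ∑ i, if (fun x : Υ.supp γ => y i x) = s then w i else 0

theorem mixture_mem_NC {ι : Type} [Fintype ι] (w : ι → ℝ) (y : ι → ∀ x, Υ.O x)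
    (hw : ∀ i, 0 ≤ w i) (h1 : ∑ i, w i = 1) : mixture w y ∈ Υ.NC :=
  mem_NC_of_mixture w y hw h1 fun _ _ => rfl

/-- Both marginals on the intersection are marginals of the same global distribution. -/
theorem NC_subset_ND : Υ.NC ⊆ Υ.ND := by
  rintro B ⟨hB, P, -, -, hP⟩
  refine ⟨hB, fun γ γ' u => ?_⟩
  have key : ∀ (δ : Υ.Ctx) (h : Υ.supp γ ∩ Υ.supp γ' ⊆ Υ.supp δ),
      marginal h (B δ) u =
        ∑ t, (if (fun x : (Υ.supp γ ∩ Υ.supp γ' : Finset Υ.M) => t x) = u then 1 else 0) * P t := by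
    intro δ h
    have := sum_mul_mixture P (fun t => t) (fun s => (hP δ s).symm)
      fun s => if restrict h s = u then 1 else 0
    refine Eq.trans ?_ this
    exact Finset.sum_congr rfl fun s _ => by split_ifs <;> simp
  rw [key, key]

theorem IsBehavior.mix {B D : Υ.Table} (hB : IsBehavior B) (hD : IsBehavior D) {c : ℝ}
    (h0 : 0 ≤ c) (h1 : c ≤ 1) : IsBehavior (c • B + (1 - c) • D) := by
  refine fun γ => ⟨fun s => ?_, ?_⟩
  · exact add_nonneg (mul_nonneg h0 ((hB γ).1 s)) (mul_nonneg (by linarith) ((hD γ).1 s))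
  · simp only [Pi.add_apply, Pi.smul_apply, smul_eq_mul, Finset.sum_add_distrib,
      ← Finset.mul_sum, (hB γ).2, (hD γ).2]
    ring

theorem mix_mem_ND {B D : Υ.Table} (hB : B ∈ Υ.ND) (hD : D ∈ Υ.ND) {c : ℝ}
    (h0 : 0 ≤ c) (h1 : c ≤ 1) : c • B + (1 - c) • D ∈ Υ.ND := by
  refine ⟨hB.1.mix hD.1 h0 h1, fun γ γ' u => ?_⟩
  have key : ∀ (δ : Υ.Ctx) (h : Υ.supp γ ∩ Υ.supp γ' ⊆ Υ.supp δ),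
      marginal h ((c • B + (1 - c) • D) δ) u
        = c * marginal h (B δ) u + (1 - c) * marginal h (D δ) u := by
    intro δ h
    simp only [marginal, Finset.mul_sum, ← Finset.sum_add_distrib]
    refine Finset.sum_congr rfl fun s _ => ?_
    split_ifs <;> simp
  rw [key, key, hB.2, hD.2]

theorem mix_mem_NC {B D : Υ.Table} (hB : B ∈ Υ.NC) (hD : D ∈ Υ.NC) {c : ℝ}
    (h0 : 0 ≤ c) (h1 : c ≤ 1) : c • B + (1 - c) • D ∈ Υ.NC := by
  refine ⟨hB.1.mix hD.1 h0 h1, ?_⟩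
  obtain ⟨-, P, hP0, hP1, hP⟩ := hB
  obtain ⟨-, Q, hQ0, hQ1, hQ⟩ := hD
  refine ⟨fun t => c * P t + (1 - c) * Q t, fun t => ?_, ?_, fun γ s => ?_⟩
  · exact add_nonneg (mul_nonneg h0 (hP0 t)) (mul_nonneg (by linarith) (hQ0 t))
  · rw [Finset.sum_add_distrib, ← Finset.mul_sum, ← Finset.mul_sum, hP1, hQ1]
    ring
  · simp only [Pi.add_apply, Pi.smul_apply, smul_eq_mul, ← hP, ← hQ, Finset.mul_sum,
      ← Finset.sum_add_distrib]
    refine Finset.sum_congr rfl fun t _ => ?_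
    split_ifs <;> simp

end Scenario

/-! ### Linearity of wirings and preservation of noncontextuality -/

namespace Wiring

variable {Υ Υ' : Scenario} (W : Wiring Υ Υ')

theorem apply_mix (B D : Υ.Table) (a b : ℝ) :
    W.apply (a • B + b • D) = a • W.apply B + b • W.apply D := by
  funext β t'
  simp only [apply, Pi.add_apply, Pi.smul_apply, smul_eq_mul, Finset.mul_sum,
    ← Finset.sum_add_distrib]
  refine Finset.sum_congr rfl fun r _ => Finset.sum_congr rfl fun s _ =>
    Finset.sum_congr rfl fun t _ => ?_
  split_ifs <;> ring

theorem apply_isBehavior {B : Υ.Table} (hB : IsBehavior B) : IsBehavior (W.apply B) := by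
  refine fun β => ⟨fun t' => ?_, ?_⟩
  · refine Finset.sum_nonneg fun r _ => Finset.sum_nonneg fun s _ =>
      Finset.sum_nonneg fun t _ => ?_
    split_ifs
    · exact mul_nonneg (mul_nonneg ((W.pre_nc.1 β).1 r) ((hB _).1 s)) ((W.pos_nc.1 _).1 t)
    · exact le_rfl
  · have hpre : ∑ r : (∀ x : Υ'.supp β, W.preO x), W.pre β r = 1 := (W.pre_nc.1 β).2
    simp only [apply]
    -- Each triple `(r, s, t)` has exactly one output, so the sum over `t'` removes the indicator;
    -- then the three boxes are summed out, the post-processing box first.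
    rw [Finset.sum_comm, ← hpre]
    refine Finset.sum_congr rfl fun r _ => ?_
    rw [Finset.sum_comm]
    calc _ = ∑ s, W.pre β r * B (W.f β r) s := Finset.sum_congr rfl fun s _ => by
          rw [Finset.sum_comm]
          simp only [Finset.sum_ite_eq, Finset.mem_univ, if_true, ← Finset.mul_sum,
            (W.pos_nc.1 _).2, mul_one]
      _ = _ := by rw [← Finset.mul_sum, (hB _).2, mul_one]

/-- The outcome of `x` in the context `β` for given global assignments of the three boxes. -/
def wireOut (r : ∀ x, W.preO x) (s : ∀ x, Υ.O x) (t : ∀ x, W.pos.O x) (β : Υ'.Ctx)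
    (x : Υ'.supp β) : Υ'.O x :=
  W.dec x _ (t (W.g β (fun y => r y) x (W.src β (fun y => r y) x)
    (s (W.src β (fun y => r y) x))))

variable {W}

/-- Locality is what makes the deterministic outcome of `x` independent of the context, so that
these outcomes glue to a global assignment. -/
theorem IsLocal.wireOut_eq (hW : W.IsLocal) (r : ∀ x, W.preO x) (s : ∀ x, Υ.O x)
    (t : ∀ x, W.pos.O x) (β β' : Υ'.Ctx) (x : Υ'.M) (h : x ∈ Υ'.supp β) (h' : x ∈ Υ'.supp β') :
    W.wireOut r s t β ⟨x, h⟩ = W.wireOut r s t β' ⟨x, h'⟩ := by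
  obtain ⟨h1, h2⟩ := hW β β' (fun y => r y) (fun y => r y) x h h' rfl
  -- The type of the argument of `dec` depends on the selected measurement, so the equalities are
  -- substituted for variables instead of being rewritten.
  have key : ∀ (m m' : Υ.M) (G G' : ∀ m : Υ.M, Υ.O m → W.pos.M), m = m' → G = G' →
      W.dec x _ (t (G m (s m))) = W.dec x _ (t (G' m' (s m'))) := by
    rintro m _ G _ rfl rfl
    rfl
  exact key _ _ _ _ h1 h2

/-- A per-wire wiring does not create contextuality. -/
theorem IsLocal.apply_mem_NC (hW : W.IsLocal) {B : Υ.Table} (hB : B ∈ Υ.NC) :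
    W.apply B ∈ Υ'.NC := by
  classical
  obtain ⟨-, P, hP0, hP1, hP⟩ := hB
  obtain ⟨-, R, hR0, hR1, hR⟩ := W.pre_nc
  obtain ⟨-, Q, hQ0, hQ1, hQ⟩ := W.pos_nc
  -- The hidden variable is a triple of global assignments, one for each box. The default value
  -- concerns only measurements that lie in no context.
  let y : ((∀ x, W.preO x) × (∀ x, Υ.O x) × (∀ x, W.pos.O x)) → ∀ x, Υ'.O x := fun i x =>
    if h : ∃ β, x ∈ Υ'.supp β then W.wireOut i.1 i.2.1 i.2.2 h.choose ⟨x, h.choose_spec⟩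
    else Classical.arbitrary _
  have hy : ∀ i β, (fun x : Υ'.supp β => y i x) = W.wireOut i.1 i.2.1 i.2.2 β := by
    intro i β
    funext ⟨x, hx⟩
    have h : ∃ β, x ∈ Υ'.supp β := ⟨β, hx⟩
    simp only [y, dif_pos h]
    exact hW.wireOut_eq _ _ _ _ _ _ _ _
  refine mem_NC_of_mixture (fun i => R i.1 * P i.2.1 * Q i.2.2) y
    (fun i => mul_nonneg (mul_nonneg (hR0 _) (hP0 _)) (hQ0 _)) ?_ fun β u => ?_
  · simp only [Fintype.sum_prod_type, ← Finset.mul_sum, hQ1, mul_one, hP1]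
    exact hR1
  · simp only [hy, Fintype.sum_prod_type]
    -- `e1`, `e2`, `e3` replace the sums over context outcomes by sums over global assignments:
    -- post-processing box, input box, pre-processing box.
    have e1 : ∀ r s, (∑ t : W.pos.Out (W.pos.supp (W.δ β r s)),
        if W.output β r s t = u then W.pre β r * B (W.f β r) s * W.posBox (W.δ β r s) t else 0)
        = (∑ t : (∀ x, W.pos.O x), (if W.output β r s (fun x => t x) = u then 1 else 0) * Q t)
          * W.pre β r * B (W.f β r) s := by
      intro r s
      rw [← sum_mul_mixture Q (fun t => t) (fun t => (hQ _ t).symm)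
        fun t => if W.output β r s t = u then 1 else 0, Finset.sum_mul, Finset.sum_mul]
      refine Finset.sum_congr rfl fun t _ => ?_
      split_ifs <;> ring
    have e2 : ∀ r, (∑ s : Υ.Out (Υ.supp (W.f β r)),
        (∑ t : (∀ x, W.pos.O x), (if W.output β r s (fun x => t x) = u then 1 else 0) * Q t)
          * W.pre β r * B (W.f β r) s)
        = (∑ s : (∀ x, Υ.O x), (∑ t : (∀ x, W.pos.O x),
          (if W.output β r (fun x => s x) (fun x => t x) = u then 1 else 0) * Q t) * P s)
          * W.pre β r := by
      intro r
      rw [sum_mul_mixture P (fun s => s) (fun s => (hP _ s).symm), Finset.sum_mul]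
      exact Finset.sum_congr rfl fun s _ => by ring
    have e3 := sum_mul_mixture (Υ := Υ'.withOutcomes W.preO) R (fun r => r)
      (fun r => (hR β r).symm) fun r => ∑ s : (∀ x, Υ.O x), (∑ t : (∀ x, W.pos.O x),
          (if W.output β r (fun x => s x) (fun x => t x) = u then 1 else 0) * Q t) * P s
    simp only [apply, e1, e2]
    refine e3.trans ?_
    refine Finset.sum_congr rfl fun r _ => ?_
    rw [Finset.sum_mul]
    refine Finset.sum_congr rfl fun s _ => ?_
    rw [Finset.sum_mul, Finset.sum_mul]
    refine Finset.sum_congr rfl fun t _ => ?_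
    have : W.output β (fun x => r x) (fun x => s x) (fun x => t x) = W.wireOut r s t β := rfl
    rw [this]
    split_ifs <;> ring

end Wiring

theorem IsNCW.apply_mem_NC {m : FeedForward} {Υ Υ' : Scenario} {W : Wiring Υ Υ'}
    (hW : IsNCW m W) {B : Υ.Table} (hB : B ∈ Υ.NC) : W.apply B ∈ Υ'.NC := by
  cases m
  · exact Wiring.IsLocal.apply_mem_NC hW hB
  · exact hW.2 B hB

/-! ### Mixing with a noncontextual behavior by shared randomness -/

namespace Scenario

variable (Υ : Scenario)

/-- The scenario of the pairs of a measurement and one of its outcomes, with trivial outcomes: its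
contexts are the joint outcomes of the contexts of `Υ`. -/
def outcomeScenario : Scenario where
  M := Σ x, Υ.O x
  Ctx := Σ γ, Υ.Out (Υ.supp γ)
  supp c := Finset.univ.image fun x : Υ.supp c.1 => ⟨x, c.2 x⟩
  O _ := Unit
  antichain := by
    rintro ⟨γ, s⟩ ⟨γ', s'⟩ h
    have h' : ∀ x : Υ.supp γ, ∃ y : Υ.supp γ', (⟨y, s' y⟩ : Σ x, Υ.O x) = ⟨x, s x⟩ := fun x => by
      simpa using h (Finset.mem_image_of_mem _ (Finset.mem_univ x))
    obtain rfl : γ = γ' := Υ.antichain _ _ fun x hx => by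
      obtain ⟨y, hy⟩ := h' ⟨x, hx⟩
      have : (y : Υ.M) = x := congrArg Sigma.fst hy
      exact this ▸ y.2
    congr
    funext x
    obtain ⟨y, hy⟩ := h' x
    obtain rfl : y = x := Subtype.ext (congrArg Sigma.fst hy)
    simpa using hy.symm

instance (x : Υ.outcomeScenario.M) : Subsingleton (Υ.outcomeScenario.O x) :=
  inferInstanceAs (Subsingleton Unit)

variable {Υ}

/-- With trivial outcomes every context has a single joint outcome, of probability one. -/
theorem one_mem_NC [∀ x, Subsingleton (Υ.O x)] : (1 : Υ.Table) ∈ Υ.NC :=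
  mem_NC_of_mixture (fun _ : Unit => 1) (fun _ x => Classical.arbitrary (Υ.O x))
    (fun _ => zero_le_one) (by simp) fun γ s => by
      rw [Fintype.sum_unique, if_pos (Subsingleton.elim _ _)]
      rfl

end Scenario

theorem Wiring.sum_pos_of_output_eq {Υ Υ' : Scenario} (W : Wiring Υ Υ')
    (β : Υ'.Ctx) (r : ∀ x : Υ'.supp β, W.preO x)
    (s : Υ.Out (Υ.supp (W.f β r))) (u v : Υ'.Out (Υ'.supp β)) (c : ℝ)
    (hv : ∀ t, W.output β r s t = v) :
    (∑ t, if W.output β r s t = u then c * W.posBox (W.δ β r s) t else 0) =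
      if v = u then c else 0 := by
  have h := (W.pos_nc.1 (W.δ β r s)).2
  simp only [hv]
  split_ifs
  · rw [← Finset.mul_sum, h, mul_one]
  · simp

/-- The wiring that, with shared randomness `ω` of weight `μ ω`, either keeps the outcomes of a box
(`ω = none`) or replaces them by those of a global assignment (`ω = some t`). -/
noncomputable def mixWiring (Υ : Scenario) (μ : Option (∀ x, Υ.O x) → ℝ) (h0 : ∀ ω, 0 ≤ μ ω)
    (h1 : ∑ ω, μ ω = 1) : Wiring Υ Υ where
  preO _ := Option (∀ x, Υ.O x)
  pre := mixture (Υ := Υ.withOutcomes fun _ => Option (∀ x, Υ.O x)) μ fun ω _ => ω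
  -- All pre-processing measurements return the same `ω`, which is why the randomness is shared and
  -- the box noncontextual.
  pre_nc := mixture_mem_NC (Υ := Υ.withOutcomes fun _ => Option (∀ x, Υ.O x)) μ _ h0 h1
  f β _ := β
  src _ _ x := x
  pos := Υ.outcomeScenario
  posBox := 1
  pos_nc := one_mem_NC
  g _ r x m o := ⟨m, (r x).elim o fun t => t m⟩
  δ β r s := ⟨β, fun x => (r x).elim (s x) fun t => t x⟩
  supp_δ _ _ _ := rfl
  -- The outcome of `x` is carried by the label of the selected pair. The wire of `x` always selects
  -- a pair over `x`, so the default is never used.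
  dec x d _ := if h : d.1 = x then h ▸ d.2 else Classical.arbitrary _

theorem mixWiring_isLocal (Υ : Scenario) (μ : Option (∀ x, Υ.O x) → ℝ) (h0 : ∀ ω, 0 ≤ μ ω)
    (h1 : ∑ ω, μ ω = 1) : (mixWiring Υ μ h0 h1).IsLocal := by
  intro β β' r r' x h h' e
  refine ⟨rfl, ?_⟩
  simp only [mixWiring]
  rw [e]

/-- Conditioned on `ω = none` the box is passed on; conditioned on `ω = some t` its outcomes are
discarded, and normalization of `B` leaves the deterministic behavior of `t`. -/
theorem mixWiring_apply (Υ : Scenario) (μ : Option (∀ x, Υ.O x) → ℝ) (h0 : ∀ ω, 0 ≤ μ ω)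
    (h1 : ∑ ω, μ ω = 1) {B : Υ.Table} (hB : IsBehavior B) (β : Υ.Ctx)
    (u : Υ.Out (Υ.supp β)) :
    (mixWiring Υ μ h0 h1).apply B β u = μ none * B β u +
      ∑ t : (∀ x, Υ.O x), if (fun x : Υ.supp β => t x) = u then μ (some t) else 0 := by
  set W := mixWiring Υ μ h0 h1
  have e1 : ∀ (r : ∀ x : Υ.supp β, W.preO x) (s : Υ.Out (Υ.supp β)), (∑ t,
      if W.output β r s t = u then W.pre β r * B β s * W.posBox (W.δ β r s) t else 0) =
      (if (fun x : Υ.supp β => (r x).elim (s x) fun t => t x) = u then B β s else 0)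
        * W.pre β r := by
    intro r s
    rw [ite_mul, zero_mul, mul_comm (B β s)]
    refine W.sum_pos_of_output_eq β r s u _ _ fun t => ?_
    funext x
    exact dif_pos rfl
  have e2 := sum_mul_mixture (Υ := Υ.withOutcomes W.preO) μ (fun ω _ => ω)
    (γ := β) (p := W.pre β) (fun _ => rfl) fun r => ∑ s : Υ.Out (Υ.supp β),
      if (fun x : Υ.supp β => (r x).elim (s x) fun t => t x) = u then B β s else 0
  have e3 : W.apply B β u = ∑ r : (∀ x : Υ.supp β, W.preO x), (∑ s : Υ.Out (Υ.supp β),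
      if (fun x : Υ.supp β => (r x).elim (s x) fun t => t x) = u then B β s else 0)
        * W.pre β r := by
    refine Finset.sum_congr rfl fun r _ => ?_
    rw [Finset.sum_mul]
    exact Finset.sum_congr rfl fun s _ => e1 r s
  rw [e3]
  refine e2.trans ?_
  rw [Fintype.sum_option]
  congr 1
  · rw [mul_comm]
    exact congrArg (μ none * ·)
      ((Finset.sum_ite_eq' Finset.univ u (B β)).trans (if_pos (Finset.mem_univ u)))
  · refine Finset.sum_congr rfl fun t _ => ?_
    change (∑ s, if (fun x : Υ.supp β => t x) = u then B β s else 0) * μ (some t) = _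
    split_ifs
    · rw [(hB β).2, one_mul]
    · rw [Finset.sum_const_zero, zero_mul]

/-- Every non-disturbing behavior can be mixed with a noncontextual one. -/
theorem converts_mix (m : FeedForward) {Υ : Scenario} (B B' : Υ.ND) {D : Υ.Table} (hD : D ∈ Υ.NC)
    {c : ℝ} (h0 : 0 ≤ c) (h1 : c ≤ 1) (h : (B' : Υ.Table) = c • (B : Υ.Table) + (1 - c) • D) :
    Converts m ⟨Υ, B⟩ ⟨Υ, B'⟩ := by
  obtain ⟨-, P, hP0, hP1, hP⟩ := id hD
  -- The box is kept with probability `c`; otherwise an assignment is drawn from the global section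
  -- `P` of `D`.
  have hμ0 : ∀ ω : Option (∀ x, Υ.O x), 0 ≤ ω.elim c fun t => (1 - c) * P t := by
    rintro (_ | t)
    · exact h0
    · exact mul_nonneg (by linarith) (hP0 t)
  have hμ1 : ∑ ω : Option (∀ x, Υ.O x), ω.elim c (fun t => (1 - c) * P t) = 1 := by
    simp [Fintype.sum_option, ← Finset.mul_sum, hP1]
  have happ : ∀ A : Υ.Table, IsBehavior A →
      (mixWiring Υ _ hμ0 hμ1).apply A = c • A + (1 - c) • D := by
    intro A hA
    funext β u
    rw [mixWiring_apply _ _ _ _ hA]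
    simp only [Option.elim_none, Option.elim_some, Pi.add_apply, Pi.smul_apply, smul_eq_mul, ← hP,
      Finset.mul_sum, mul_ite, mul_zero]
  refine ⟨mixWiring Υ _ hμ0 hμ1, ?_, (happ _ B.2.1).trans h.symm⟩
  cases m
  · exact mixWiring_isLocal _ _ _ _
  · refine ⟨fun A hA => ?_, fun A hA => ?_⟩
    · rw [happ A hA.1]
      exact mix_mem_ND hA (NC_subset_ND hD) h0 h1
    · rw [happ A hA.1]
      exact mix_mem_NC hA hD h0 h1

/-! ### The cycle inequality and the noncontextual end of the segment -/

section Cycle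

variable {n : ℕ}

namespace CycleFacet

variable (k : CycleFacet n)

theorem prod_a : ∏ i, k.a i = -1 := by
  have h : ∀ i, k.a i = if k.a i = -1 then -1 else 1 := fun i => by
    rcases Int.units_eq_one_or (k.a i) with h | h <;> simp [h]
  rw [Finset.prod_congr rfl fun i _ => h i, ← Finset.prod_filter, Finset.prod_const]
  exact k.odd.neg_one_pow

/-- At least one sign is `-1`, which lowers the trivial bound `n` by `2`. -/
theorem sum_le_of_prod_eq_neg_one (u : Fin n → ℤˣ) (hu : ∏ i, u i = -1) :
    ∑ i, ((u i : ℤ) : ℝ) ≤ n - 2 := by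
  obtain ⟨j, hj⟩ : ∃ j, u j = -1 := by
    by_contra! h
    have : ∏ i, u i = 1 := Finset.prod_eq_one fun i _ =>
      (Int.units_eq_one_or (u i)).resolve_right (h i)
    rw [this] at hu
    exact absurd hu (by decide)
  have h : ∀ i ∈ Finset.univ, ((u i : ℤ) : ℝ) ≤ 1 - if i = j then 2 else 0 := fun i _ => by
    split_ifs with hi
    · subst hi
      rw [hj]
      norm_num
    · rcases Int.units_eq_one_or (u i) with h | h <;> simp [h]
  refine (Finset.sum_le_sum h).trans (le_of_eq ?_)
  rw [Finset.sum_sub_distrib]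
  simp

/-- The sign of an outcome. -/
def sign (b : Bool) : ℤˣ := if b then -1 else 1

theorem sign_mul_sign (b b' : Bool) : sign b * sign b' = if b = b' then 1 else -1 := by
  revert b b'
  decide

variable [Fact (3 ≤ n)]

theorem abs_corr_le {B : (nCycle n).Table} (hB : IsBehavior B) (i : Fin n) : |corr B i| ≤ 1 := by
  rw [← (hB i).2]
  refine (Finset.abs_sum_le_sum_abs _ _).trans (Finset.sum_le_sum fun s _ => ?_)
  rw [abs_mul, abs_of_nonneg ((hB i).1 s)]
  split_ifs <;> simp

theorem I_le_of_isBehavior {B : (nCycle n).Table} (hB : IsBehavior B) : k.I B ≤ n := by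
  have h : ∀ i ∈ Finset.univ, ((k.a i : ℤ) : ℝ) * corr B i ≤ 1 := fun i _ => by
    have := abs_le.1 (abs_corr_le hB i)
    rcases Int.units_eq_one_or (k.a i) with h | h <;> simp [h] <;> linarith
  simpa [I] using Finset.sum_le_sum h

theorem I_mix (B D : (nCycle n).Table) (a b : ℝ) :
    k.I (a • B + b • D) = a * k.I B + b * k.I D := by
  simp only [I, corr, Pi.add_apply, Pi.smul_apply, smul_eq_mul, Finset.mul_sum,
    ← Finset.sum_add_distrib]
  exact Finset.sum_congr rfl fun i _ => Finset.sum_congr rfl fun s _ => by ring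

/-- The facet inequality of the noncontextual polytope. -/
theorem I_le_of_mem_NC {B : (nCycle n).Table} (hB : B ∈ (nCycle n).NC) : k.I B ≤ n - 2 := by
  obtain ⟨-, P, hP0, hP1, hP⟩ := hB
  have hc : ∀ i, corr B i =
      ∑ t : Fin n → Bool, (((sign (t i) * sign (t (i + 1)) : ℤˣ) : ℤ) : ℝ) * P t := by
    intro i
    refine (sum_mul_mixture (Υ := nCycle n) P (fun t => t) (fun s => (hP i s).symm) _).trans ?_
    refine Finset.sum_congr rfl fun t _ => ?_
    rw [sign_mul_sign]
    change (if t i = t (i + 1) then 1 else -1) * P t = _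
    by_cases h : t i = t (i + 1)
    · rw [if_pos h, if_pos h, Units.val_one, Int.cast_one]
    · rw [if_neg h, if_neg h, Units.val_neg, Units.val_one, Int.cast_neg, Int.cast_one]
  have hI : k.I B = ∑ t : Fin n → Bool, P t *
      ∑ i, (((k.a i * (sign (t i) * sign (t (i + 1))) : ℤˣ) : ℤ) : ℝ) := by
    simp only [I, hc, Finset.mul_sum]
    rw [Finset.sum_comm]
    refine Finset.sum_congr rfl fun t _ => Finset.sum_congr rfl fun i _ => ?_
    push_cast
    ring
  have hle : ∀ t : Fin n → Bool,
      ∑ i, (((k.a i * (sign (t i) * sign (t (i + 1))) : ℤˣ) : ℤ) : ℝ) ≤ n - 2 := by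
    intro t
    refine sum_le_of_prod_eq_neg_one _ ?_
    -- Each vertex sign enters two edges and cancels, so the edge signs multiply to `∏ a_i = -1`.
    have : ∏ i, sign (t (i + 1)) = ∏ i, sign (t i) :=
      Equiv.prod_comp (Equiv.addRight (1 : Fin n)) fun i => sign (t i)
    rw [Finset.prod_mul_distrib, Finset.prod_mul_distrib, this, prod_a, Int.units_mul_self, mul_one]
  rw [hI]
  calc _ ≤ ∑ t : Fin n → Bool, P t * ((n : ℝ) - 2) :=
        Finset.sum_le_sum fun t _ => mul_le_mul_of_nonneg_left (hle t) (hP0 t)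
    _ = _ := by
        rw [← Finset.sum_mul]
        refine (congrArg (· * ((n : ℝ) - 2)) hP1).trans (one_mul _)

theorem I_segmentTable (ε : ℝ) : k.I (k.segmentTable ε) = n + 2 * (ε - 1) := by
  have h3 := Fact.out (p := 3 ≤ n)
  have hn : (n : ℝ) ≠ 0 := by positivity
  have hc : ∀ i, ((k.a i : ℤ) : ℝ) * corr (k.segmentTable ε) i = 1 + 2 * (ε - 1) / n := by
    intro i
    rw [segmentTable_eq, corr, ← (outEquiv i).symm.sum_comp]
    have hf : ∀ p, fstOut ((outEquiv i).symm p) = p.1 := fun p =>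
      congrArg Prod.fst ((outEquiv i).apply_symm_apply p)
    have hs : ∀ p, sndOut ((outEquiv i).symm p) = p.2 := fun p =>
      congrArg Prod.snd ((outEquiv i).apply_symm_apply p)
    simp only [hf, hs, Fintype.sum_prod_type, Fintype.sum_bool]
    rcases Int.units_eq_one_or (k.a i) with ha | ha
    · simp only [ha]
      norm_num
      field_simp
      ring
    · simp only [ha]
      norm_num
      field_simp
      ring
  simp only [I, hc, Finset.sum_const, Finset.card_univ, Fintype.card_fin, nsmul_eq_mul]
  field_simp

/-- Signs on the edges of the cycle whose product is `1` are the products of signs on the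
vertices. -/
theorem exists_eq_mul_of_prod_eq_one (u : Fin n → ℤˣ) (hu : ∏ i, u i = 1) :
    ∃ x : Fin n → ℤˣ, ∀ i, x (i + 1) = x i * u i := by
  have h3 := Fact.out (p := 3 ≤ n)
  let v : ℕ → ℤˣ := fun l => if h : l < n then u ⟨l, h⟩ else 1
  refine ⟨fun i => ∏ l ∈ Finset.range i, v l, fun i => ?_⟩
  have hv : v i = u i := dif_pos i.2
  change ∏ l ∈ Finset.range (i + 1 : Fin n), v l = (∏ l ∈ Finset.range i, v l) * u i
  rw [← hv, ← Finset.prod_range_succ]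
  have h1 : ((1 : Fin n) : ℕ) = 1 := by rw [Fin.val_one', Nat.mod_eq_of_lt (by omega)]
  rw [Fin.val_add, h1]
  rcases Nat.lt_or_ge (i + 1) n with h | h
  · rw [Nat.mod_eq_of_lt h]
  -- Partial products solve the relation on all edges but the closing one, where `hu` is needed.
  · have : (i : ℕ) + 1 = n := by have := i.2; omega
    rw [this, Nat.mod_self, Finset.prod_range_zero, ← Fin.prod_univ_eq_prod_range, ← hu]
    exact Finset.prod_congr rfl fun i _ => (dif_pos i.2 : v i = u i).symm

/-- There are assignments of outcomes that violate precisely the `j`-th one of the relations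
prescribed by the signs. -/
theorem exists_assignment (j : Fin n) :
    ∃ x : Fin n → Bool, ∀ i, (x i = x (i + 1)) ↔ (k.a i = 1 ↔ i ≠ j) := by
  -- Flipping the sign of edge `j` turns the product `-1` into `1`.
  obtain ⟨y, hy⟩ := exists_eq_mul_of_prod_eq_one (fun i => k.a i * if i = j then -1 else 1) (by
    rw [Finset.prod_mul_distrib, prod_a, Finset.prod_ite_eq' Finset.univ j]
    simp)
  refine ⟨fun i => decide (y i = -1), fun i => ?_⟩
  simp only [hy i, decide_eq_decide]
  by_cases hij : i = j <;> rcases Int.units_eq_one_or (k.a i) with ha | ha <;>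
    rcases Int.units_eq_one_or (y i) with hyi | hyi <;> simp [hij, ha, hyi] <;> subst hij <;>
    simp [ha, hyi]

/-- The hidden variable is a uniform edge `j`, the only one whose relation is violated, together
with a uniform global flip. An edge is then violated with probability `1/n`, split equally between
two joint outcomes. -/
theorem segmentTable_zero_mem_NC : k.segmentTable 0 ∈ (nCycle n).NC := by
  have h3 := Fact.out (p := 3 ≤ n)
  have hn : (n : ℝ) ≠ 0 := by positivity
  choose x hx using k.exists_assignment
  refine mem_NC_of_mixture (Υ := nCycle n) (fun _ : Fin n × Bool => 1 / (2 * (n : ℝ)))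
    (fun p i => xor p.2 (x p.1 i)) (fun _ => by positivity) ?_ fun i s => ?_
  · simp only [Finset.sum_const, Finset.card_univ, Fintype.card_prod, Fintype.card_fin,
      Fintype.card_bool, nsmul_eq_mul]
    push_cast
    field_simp
  · have hs : ∀ t : Fin n → Bool, ((fun y : (nCycle n).supp i => t y) = s) ↔
        t i = fstOut s ∧ t (i + 1) = sndOut s := fun t => by
      rw [← (outEquiv i).apply_eq_iff_eq, Prod.ext_iff]
      rfl
    -- Exactly one flip `b` matches `s` at `x_i`; it also matches at `x_{i+1}` precisely when `s`
    -- and the assignment agree on whether the two outcomes are equal.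
    have hj : ∀ j, (∑ b, if (fun y : (nCycle n).supp i => xor b (x j y)) = s
        then 1 / (2 * (n : ℝ)) else 0) =
        if (fstOut s = sndOut s ↔ (k.a i = 1 ↔ i ≠ j)) then 1 / (2 * (n : ℝ)) else 0 := by
      intro j
      refine (Finset.sum_congr rfl fun b _ => if_congr (hs fun y => xor b (x j y)) rfl rfl :
        _ = ∑ b : Bool, (if xor b (x j i) = fstOut s ∧ xor b (x j (i + 1)) = sndOut s
          then 1 / (2 * (n : ℝ)) else 0)).trans ?_
      simp only [← hx j i, Fintype.sum_bool]
      cases fstOut s <;> cases sndOut s <;> cases x j i <;> cases x j (i + 1) <;> simp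
    rw [Fintype.sum_prod_type, segmentTable_eq]
    simp only [hj]
    by_cases hr : (fstOut s = sndOut s ↔ k.a i = 1)
    · have : ∀ j, (if (fstOut s = sndOut s ↔ (k.a i = 1 ↔ i ≠ j)) then 1 / (2 * (n : ℝ)) else 0) =
          1 / (2 * (n : ℝ)) - if i = j then 1 / (2 * (n : ℝ)) else 0 := fun j => by
        by_cases hij : i = j
        · rw [if_pos hij, if_neg (by tauto), sub_self]
        · rw [if_neg hij, if_pos (by tauto), sub_zero]
      rw [if_pos hr, Finset.sum_congr rfl fun j _ => this j, Finset.sum_sub_distrib]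
      simp
      field_simp
    · have : ∀ j, (if (fstOut s = sndOut s ↔ (k.a i = 1 ↔ i ≠ j)) then 1 / (2 * (n : ℝ)) else 0) =
          if i = j then 1 / (2 * (n : ℝ)) else 0 := fun j => by
        by_cases hij : i = j
        · rw [if_pos hij, if_pos (by tauto)]
        · rw [if_neg hij, if_neg (by tauto)]
      rw [if_neg hr, Finset.sum_congr rfl fun j _ => this j]
      simp

/-! ### The order on the segment, cost and uncountability -/

theorem segmentTable_eq_mix (ε : ℝ) :
    k.segmentTable ε = ε • k.segmentTable 1 + (1 - ε) • k.segmentTable 0 := by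
  simp [segmentTable]

theorem converts_segment (m : FeedForward) {ε ε' : unitInterval} (h : ε ≤ ε') :
    Converts m (k.segment ε') (k.segment ε) := by
  have h' : (ε : ℝ) ≤ ε' := h
  have h0 : (0 : ℝ) ≤ ε := ε.2.1
  rcases eq_or_lt_of_le (h0.trans h') with hz | hz
  · refine converts_mix m _ _ k.segmentTable_zero_mem_NC zero_le_one le_rfl ?_
    obtain rfl : ε = ε' := Subtype.ext (by linarith)
    simp
  -- Mixing with `B_0` scales the weight of `B_1` from `ε'` to `c ε'`, which has to be `ε`.
  · refine converts_mix m _ _ k.segmentTable_zero_mem_NC (c := ε / ε') (by positivity)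
      ((div_le_one hz).2 h') ?_
    dsimp only
    rw [k.segmentTable_eq_mix ε, k.segmentTable_eq_mix ε', smul_add, smul_smul, smul_smul,
      add_assoc, ← add_smul]
    congr 2
    · field_simp
    · field_simp
      ring

/-- Linearity reduces the bound on `I` of the image to the two ends of the segment: `n` at the
vertex, `n - 2` at the noncontextual end. -/
theorem le_of_converts_segment {m : FeedForward} {ε ε' : unitInterval}
    (h : Converts m (k.segment ε') (k.segment ε)) : ε ≤ ε' := by
  obtain ⟨W, hW, h⟩ := h
  change Wiring (nCycle n) (nCycle n) at W
  change W.apply (k.segmentTable ε') = k.segmentTable ε at h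
  have h1 : k.I (W.apply (k.segmentTable 1)) ≤ n :=
    k.I_le_of_isBehavior (W.apply_isBehavior (segmentTable_isBehavior k 1))
  have h2 : k.I (W.apply (k.segmentTable 0)) ≤ n - 2 :=
    k.I_le_of_mem_NC (hW.apply_mem_NC k.segmentTable_zero_mem_NC)
  have h3 := congrArg k.I h
  rw [k.segmentTable_eq_mix ε', W.apply_mix, I_mix, I_segmentTable] at h3
  have h4 : (0 : ℝ) ≤ ε' := ε'.2.1
  have h5 : (ε' : ℝ) ≤ 1 := ε'.2.2
  have : (ε : ℝ) ≤ ε' := by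
    have := mul_le_mul_of_nonneg_left h1 h4
    have := mul_le_mul_of_nonneg_left h2 (sub_nonneg.2 h5)
    linarith
  exact this

theorem converts_segment_iff {m : FeedForward} {ε ε' : unitInterval} :
    Converts m (k.segment ε') (k.segment ε) ↔ ε ≤ ε' :=
  ⟨k.le_of_converts_segment, k.converts_segment m⟩

theorem equivalent_segment_iff {m : FeedForward} {ε ε' : unitInterval} :
    Equivalent m (k.segment ε) (k.segment ε') ↔ ε = ε' := by
  rw [Equivalent, converts_segment_iff, converts_segment_iff, and_comm, ← le_antisymm_iff]

/-- The infimum is attained at the point itself, since only points with larger or equal parameter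
convert to it. -/
theorem cost_segment (m : FeedForward) (ε : unitInterval) :
    k.cost m ⟨k.segmentTable ε, segmentTable_mem_ND k ε⟩ =
      (((n : ℝ) + 2 * ((ε : ℝ) - 1) : ℝ) : EReal) := by
  refine IsLeast.csInf_eq ⟨⟨ε, k.converts_segment m le_rfl, by rw [I_segmentTable]⟩, ?_⟩
  rintro _ ⟨ε', h, rfl⟩
  have h' : (ε : ℝ) ≤ ε' := k.le_of_converts_segment h
  rw [I_segmentTable, EReal.coe_le_coe_iff]
  linarith

theorem injective_equivClass_segment (m : FeedForward) :
    Function.Injective fun ε => equivClass m (k.segment ε) := by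
  intro ε ε' h
  have : k.segment ε' ∈ equivClass m (k.segment ε') := k.equivalent_segment_iff.2 rfl
  exact k.equivalent_segment_iff.1 ((congrArg (k.segment ε' ∈ ·) h).mpr this)

theorem not_countable_equivClass_segment (m : FeedForward) {ε₁ ε₂ : unitInterval} (h : ε₁ < ε₂) :
    ¬ (equivClass m '' (k.segment '' Set.Icc ε₁ ε₂)).Countable := by
  rw [Set.image_image]
  intro hc
  replace hc := Set.countable_of_injective_of_countable_image
    (k.injective_equivClass_segment m).injOn hc
  have h' : (ε₁ : ℝ) < ε₂ := h
  have h1 : (ε₂ : ℝ) ≤ 1 := ε₂.2.2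
  have h0 : (0 : ℝ) ≤ ε₁ := ε₁.2.1
  refine ((not_congr Cardinal.Real.Icc_countable_iff).2 (not_le.2 h'))
    ((hc.image Subtype.val).mono fun x hx => ?_)
  exact ⟨⟨x, h0.trans hx.1, hx.2.trans h1⟩, ⟨hx.1, hx.2⟩, rfl⟩

theorem not_countable_classesBetween (m : FeedForward) {ε₁ ε₂ : unitInterval} (h : ε₁ < ε₂) :
    ¬ (classesBetween m (k.segment ε₂) (k.segment ε₁)).Countable := by
  refine fun hc => k.not_countable_equivClass_segment m h (hc.mono (Set.image_mono ?_))
  rintro _ ⟨ε, hε, rfl⟩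
  exact ⟨k.converts_segment m hε.2, k.converts_segment m hε.1⟩

end CycleFacet

end Cycle

/-- The pre-order of noncontextual wirings is locally infinite. -/
theorem mainTheorem8 (m : FeedForward) :
    ¬ IntervalsFinite m ∧
    (∃ B₁ B₂ : Resource, Converts m B₁ B₂ ∧ ¬ Equivalent m B₁ B₂ ∧
      ¬ (classesBetween m B₁ B₂).Countable) ∧
    ∀ (n : ℕ) [Fact (3 ≤ n)] (k : CycleFacet n) (ε₁ ε₂ : unitInterval), ε₁ < ε₂ →
      (∀ ε ∈ Set.Icc ε₁ ε₂,
        Converts m (k.segment ε₂) (k.segment ε) ∧ Converts m (k.segment ε) (k.segment ε₁) ∧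
        k.cost m ⟨k.segmentTable ε, segmentTable_mem_ND k ε⟩ =
          (((n : ℝ) + 2 * ((ε : ℝ) - 1) : ℝ) : EReal)) ∧
      (∀ ε ∈ Set.Icc ε₁ ε₂, ∀ ε' ∈ Set.Icc ε₁ ε₂, ε ≠ ε' →
        ¬ Equivalent m (k.segment ε) (k.segment ε')) ∧
      ¬ (equivClass m '' (k.segment '' Set.Icc ε₁ ε₂)).Countable ∧
      ¬ (classesBetween m (k.segment ε₂) (k.segment ε₁)).Countable := by
  have : Fact (3 ≤ 3) := ⟨le_rfl⟩
  -- In the triangle, three negative signs are an odd number.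
  let k : CycleFacet 3 := ⟨fun _ => -1, by decide⟩
  have h01 : (0 : unitInterval) < 1 := zero_lt_one
  have hne : ¬ Equivalent m (k.segment 1) (k.segment 0) :=
    k.equivalent_segment_iff.not.2 h01.ne'
  have hunc := k.not_countable_classesBetween m h01
  refine ⟨fun hfin => hunc (hfin _ _ hne).countable,
    ⟨_, _, k.converts_segment m h01.le, hne, hunc⟩, fun n _ k ε₁ ε₂ h => ⟨fun ε hε =>
      ⟨k.converts_segment m hε.2, k.converts_segment m hε.1, k.cost_segment m ε⟩,
      fun ε _ ε' _ hε => k.equivalent_segment_iff.not.2 hε,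
      k.not_countable_equivClass_segment m h, k.not_countable_classesBetween m h⟩⟩
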